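/- Let $E$ be a nonempty Polish space and let $P$ be a Markov transition kernel on $E$ (with its Borel $\sigma$-algebra). For $x\in E$ let $P_x$ be the law on $E^{\mathbb N}$ of the Markov chain $(X_n)_{n\ge 0}$ with transition kernel $P$ and $X_0=x$, and let $$\Lambda_n=\frac1n\sum_{k=0}^{n-1}\delta_{X_k},\qquad n\ge 1,$$ be its empirical occupation measures. Assume that $P$ is quasi-Feller, that is, there exist a Polish space $W$, a Borel map $H:E\to W$ such that $H(K)$ is compact for every compact $K\subset E$, and a Markov transition kernel $Q$ from $W$ to $E$ such that (i) $w\mapsto \int_E f(y)\,Q(w,dy)$ is bounded and continuous on $W$ for every $f\in C_b(E)$; (ii) $P(x,\cdot)=Q(H(x),\cdot)$ for every $x\in E$; (iii) $\mu(D_H)=0$ for every $P$-invariant probability measure $\mu$, where $D_H$ is the set of discontinuity points of $H$. Assume moreover that, for every $x\in E$, the sequence $(\Lambda_n)_{n\ge1}$ is $P_x$-almost surely tight. **Theorem (stability induced by uniqueness).** Under these assumptions $P$ admits at least one invariant probability measure. If the invariant probability measure $\mu$ is unique, then the chain is stable in the sense of Duflo with limit $\mu$: for every $x\in E$ and every $f\in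 C_b(E)$, $$\frac1n\sum_{k=0}^{n-1} f(X_k)\;\longrightarrow\;\int_E f\,d\mu\qquad P_x\text{-almost surely as } n\to\infty.$$ -/

import Mathlib

open MeasureTheory ProbabilityTheory Filter Topology
open scoped ENNReal BoundedContinuousFunction

universe u v

namespace QuasiFellerChain

/-- The law `P_x` on the trajectory space `ℕ → E` of the time-homogeneous Markov chain with
transition kernel `P` started at `x` (Ionescu-Tulcea). The chain itself is the coordinate process
`X_k ω = ω k`. -/
noncomputable def pathLaw {E : Type*} [MeasurableSpace E] (P : Kernel E E) [IsMarkovKernel P]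
    (x : E) : Measure (ℕ → E) :=
  Kernel.traj (X := fun _ : ℕ => E)
    (fun n => P.comap (fun h : (i : Finset.Iic n) → E => h ⟨n, Finset.mem_Iic.2 le_rfl⟩)
      (measurable_pi_apply _))
    0 (fun _ => x)

/-- The empirical occupation measure `Λ_n(ω) = (1/n) ∑_{k < n} δ_{ω k}` (meant for `n ≥ 1`). -/
noncomputable def occupationMeasure {E : Type*} [MeasurableSpace E] (ω : ℕ → E) (n : ℕ) :
    Measure E :=
  (n : ℝ≥0∞)⁻¹ • ∑ k ∈ Finset.range n, Measure.dirac (ω k)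

/-- For `P_x`-almost every trajectory, the sequence `(Λ_n)_{n ≥ 1}` is tight. -/
def OccupationTightFrom {E : Type*} [TopologicalSpace E] [MeasurableSpace E]
    (P : Kernel E E) [IsMarkovKernel P] (x : E) : Prop :=
  ∀ᵐ ω ∂(pathLaw P x), IsTightMeasureSet (occupationMeasure ω '' {n : ℕ | 1 ≤ n})

/-- `P` is quasi-Feller: `P(x, ·) = Q(H(x), ·)`, where `W` is a Polish space, `H : E → W` is Borel
and maps compact sets to compact sets, `Q` is a Markov kernel from `W` to `E` with the Feller
property, and every invariant probability measure of `P` gives mass zero to the set of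
discontinuity points of `H`. (`Qf` is automatically bounded when `f` is, so the Feller property
amounts to continuity of `Qf`.) -/
def IsQuasiFeller {E : Type u} [TopologicalSpace E] [MeasurableSpace E]
    [OpensMeasurableSpace E] (P : Kernel E E) : Prop :=
  ∃ (W : Type v) (_ : TopologicalSpace W) (_ : PolishSpace W) (_ : MeasurableSpace W)
    (_ : BorelSpace W) (H : E → W) (Q : Kernel W E),
    IsMarkovKernel Q ∧
    Measurable H ∧
    (∀ K : Set E, IsCompact K → IsCompact (H '' K)) ∧
    (∀ f : E →ᵇ ℝ, Continuous fun w => ∫ y, f y ∂(Q w)) ∧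
    (∀ x, P x = Q (H x)) ∧
    (∀ μ : Measure E, IsProbabilityMeasure μ → Kernel.Invariant P μ →
      μ {x | ¬ ContinuousAt H x} = 0)

/-- The chain with kernel `P` is stable in the sense of Duflo, with limiting probability measure
`μ`: from every starting point `x`, time averages of each bounded continuous function converge
`P_x`-almost surely to its `μ`-integral. -/
def IsDufloStableWithLimit {E : Type*} [TopologicalSpace E] [MeasurableSpace E]
    (P : Kernel E E) [IsMarkovKernel P] (μ : Measure E) : Prop :=
  IsProbabilityMeasure μ ∧
  ∀ (x : E) (f : E →ᵇ ℝ), ∀ᵐ ω ∂(pathLaw P x),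
    Tendsto (fun n : ℕ => (n : ℝ)⁻¹ * ∑ k ∈ Finset.range n, f (ω k)) atTop (𝓝 (∫ y, f y ∂μ))

end QuasiFellerChain

/-! Time averages of `f - P f` vanish almost surely by the martingale strong law, so a weak limit
`μ` of occupation measures is invariant once `∫ P f` also passes to the limit. Since `P f = (Q f) ∘
H` with `Q f` continuous, this is done on `W × E`: the occupation measures of the pairs `(H X_k,
X_k)` are tight, and it suffices that each of their limits `Γ` be carried by the graph of `H`.

The smallness of the discontinuity set `D` is known only for invariant measures, so assuming it for
`μ` would be circular. Compactness of images breaks the circle. Near a point `(w, x)` off the graph,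
`H` either avoids values near `w` (if continuous at `x`) or takes there no value near `w` other than
`w` itself (`eventually_eq_of_image_isCompact`). In the second case only visits to `A = H⁻¹{w}` can
create mass of `Γ`, and `A` is an atom: `P` equals the fixed law `q = Q w` on it.

For an atom, regeneration applies. Let `π` be the expected occupation measure, started from `q`, up
to the first visit to `A`. If `π` is infinite, `A` has asymptotic frequency zero. If finite, `π` is
invariant, hence null on `D`, and the chain spends little time in `A` near `D`
(`ae_exists_isOpen_frequency_atom_le`). Thus `Γ` does not charge the complement of the graph, every
limit is invariant, and uniqueness forces convergence. -/

namespace QuasiFellerChain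

/-! ### Strong law for bounded martingale differences and for the chain -/

/-- A form of Kronecker's lemma. -/
lemma tendsto_average_of_tendsto_weighted_sum {d : ℕ → ℝ} {l : ℝ}
    (h : Tendsto (fun n => ∑ k ∈ Finset.range n, d k / (k + 1)) atTop (𝓝 l)) :
    Tendsto (fun n : ℕ => (n : ℝ)⁻¹ * ∑ k ∈ Finset.range n, d k) atTop (𝓝 0) := by
  -- A convergent sequence minus its Cesàro means tends to zero; by summation by parts (`key`) this
  -- difference is the average of `d`.
  have hc := h.sub h.cesaro
  rw [sub_self] at hc
  refine hc.congr' ?_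
  filter_upwards [eventually_gt_atTop 0] with n hn
  have key : ∀ m : ℕ, ∑ k ∈ Finset.range m, d k
      = m * (∑ k ∈ Finset.range m, d k / (k + 1))
        - ∑ j ∈ Finset.range m, ∑ k ∈ Finset.range j, d k / (k + 1) := by
    intro m
    induction m with
    | zero => simp
    | succ m ih =>
      rw [Finset.sum_range_succ, ih, Finset.sum_range_succ (fun k : ℕ => d k / ((k : ℝ) + 1)),
        Finset.sum_range_succ (fun j => ∑ k ∈ Finset.range j, d k / ((k : ℝ) + 1))]
      have : (m : ℝ) + 1 ≠ 0 := by positivity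
      push_cast
      field_simp
      ring
  have hn' : (n : ℝ) ≠ 0 := by positivity
  rw [key n]
  field_simp

/-- Strong law of large numbers for bounded martingale differences. -/
lemma ae_tendsto_average_of_condExp_eq_zero {Ω : Type*} {m0 : MeasurableSpace Ω} {μ : Measure Ω}
    [IsProbabilityMeasure μ] (ℱ : Filtration ℕ m0) {d : ℕ → Ω → ℝ} {C : ℝ}
    (hd : ∀ k, StronglyMeasurable[ℱ (k + 1)] (d k)) (hC : ∀ k ω, |d k ω| ≤ C)
    (hcond : ∀ k, μ[d k | ℱ k] =ᵐ[μ] 0) :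
    ∀ᵐ ω ∂μ, Tendsto (fun n : ℕ => (n : ℝ)⁻¹ * ∑ k ∈ Finset.range n, d k ω) atTop (𝓝 0) := by
  -- The weights `1 / (k + 1)` make this martingale bounded in L², since its increments are
  -- orthogonal and `∑ 1 / (k + 1)²` converges; Kronecker's lemma then removes them.
  set M : ℕ → Ω → ℝ := fun n ω => ∑ k ∈ Finset.range n, d k ω / (k + 1) with hM
  have hsucc : ∀ n, M (n + 1) = fun ω => M n ω + d n ω / (n + 1) := by
    intro n; ext ω; simp [hM, Finset.sum_range_succ]
  have hadp : StronglyAdapted ℱ M := by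
    intro n
    induction n with
    | zero => simpa [hM] using stronglyMeasurable_const
    | succ n ih =>
      rw [hsucc]
      simp only [div_eq_mul_inv]
      exact (ih.mono (ℱ.mono n.le_succ)).add ((hd n).mul_const _)
  have hdint : ∀ k, Integrable (d k) μ := fun k =>
    Integrable.of_bound ((hd k).mono (ℱ.le _)).aestronglyMeasurable C
      (ae_of_all _ fun ω => hC k ω)
  have hbound : ∀ n, ∃ B, ∀ ω, ‖M n ω‖ ≤ B := by
    intro n
    refine ⟨∑ k ∈ Finset.range n, C / (k + 1), fun ω => ?_⟩
    refine (norm_sum_le _ _).trans (Finset.sum_le_sum fun k _ => ?_)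
    rw [norm_div, Real.norm_eq_abs, Real.norm_of_nonneg (by positivity : (0 : ℝ) ≤ (k : ℝ) + 1)]
    gcongr
    exact hC k ω
  have hMae : ∀ n, AEStronglyMeasurable (M n) μ := fun n =>
    ((hadp n).mono (ℱ.le _)).aestronglyMeasurable
  have hint : ∀ n, Integrable (M n) μ := by
    intro n
    obtain ⟨B, hB⟩ := hbound n
    exact Integrable.of_bound (hMae n) B (ae_of_all _ hB)
  have hmart : Martingale M ℱ μ := by
    refine martingale_of_condExp_sub_eq_zero_nat hadp hint fun i => ?_
    have h1 : M (i + 1) - M i = ((i : ℝ) + 1)⁻¹ • d i := by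
      ext ω; simp [hsucc]; ring
    rw [h1]
    filter_upwards [condExp_smul (μ := μ) ((i : ℝ) + 1)⁻¹ (d i) (ℱ i), hcond i] with ω h2 h3
    simp [h2, h3]
  have hMd : ∀ n, Integrable (fun ω => M n ω * d n ω) μ := by
    intro n
    obtain ⟨B, hB⟩ := hbound n
    exact (hdint n).bdd_mul (hMae n) (ae_of_all _ hB)
  have horth : ∀ n, ∫ ω, M n ω * d n ω ∂μ = 0 := by
    intro n
    rw [← integral_condExp (ℱ.le n)]
    refine integral_eq_zero_of_ae ?_
    have := condExp_mul_of_stronglyMeasurable_left (hadp n) (hMd n) (hdint n)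
    filter_upwards [this, hcond n] with ω h1 h2
    have h3 : (μ[fun ω => M n ω * d n ω | ℱ n]) ω = M n ω * (μ[d n | ℱ n]) ω := h1
    simp [h3, h2]
  have hsq : ∀ n, Integrable (fun ω => M n ω ^ 2) μ := by
    intro n
    obtain ⟨B, hB⟩ := hbound n
    simp only [sq]
    exact (hint n).bdd_mul (hMae n) (ae_of_all _ hB)
  have hdsq : ∀ n, Integrable (fun ω => d n ω ^ 2) μ := by
    intro n
    simp only [sq]
    exact (hdint n).bdd_mul (hdint n).1 (ae_of_all _ (hC n))
  have hsecond : ∀ n, ∫ ω, M n ω ^ 2 ∂μ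
      ≤ ∑ k ∈ Finset.range n, C ^ 2 * (1 / ((k : ℝ) + 1) ^ 2) := by
    intro n
    induction n with
    | zero => simp [hM]
    | succ n ih =>
      have h1 : ∀ ω, M (n + 1) ω ^ 2 = M n ω ^ 2 + (2 / ((n : ℝ) + 1)) * (M n ω * d n ω)
          + (1 / ((n : ℝ) + 1) ^ 2) * d n ω ^ 2 := by
        intro ω
        have : (n : ℝ) + 1 ≠ 0 := by positivity
        rw [hsucc]; field_simp; ring
      have h2 : ∫ ω, d n ω ^ 2 ∂μ ≤ C ^ 2 := by
        calc ∫ ω, d n ω ^ 2 ∂μ ≤ ∫ _, C ^ 2 ∂μ := by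
              refine integral_mono (hdsq n) (integrable_const _) fun ω => ?_
              exact sq_le_sq' (neg_le_of_abs_le (hC n ω)) (le_of_abs_le (hC n ω))
          _ = C ^ 2 := by simp
      simp_rw [h1]
      have h4 : Integrable (fun ω => M n ω ^ 2 + (2 / ((n : ℝ) + 1)) * (M n ω * d n ω)) μ :=
        (hsq n).add ((hMd n).const_mul _)
      rw [integral_add h4 ((hdsq n).const_mul _), integral_add (hsq n) ((hMd n).const_mul _),
        integral_const_mul, integral_const_mul, horth, Finset.sum_range_succ, mul_comm (C ^ 2) (1 / ((n : ℝ) + 1) ^ 2)]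
      have h3 : 1 / ((n : ℝ) + 1) ^ 2 * ∫ ω, d n ω ^ 2 ∂μ ≤ 1 / ((n : ℝ) + 1) ^ 2 * C ^ 2 := by
        gcongr
      linarith
  have hsummable : Summable fun k : ℕ => C ^ 2 * (1 / ((k : ℝ) + 1) ^ 2) := by
    have h2 : Summable fun k : ℕ => 1 / ((k : ℝ) + 1) ^ 2 := by
      simpa using (summable_nat_add_iff (f := fun k : ℕ => 1 / (k : ℝ) ^ 2) 1).2
        (Real.summable_one_div_nat_pow.2 one_lt_two)
    exact h2.mul_left (C ^ 2)
  -- The extra 1 comes from `|t| ≤ 1 + t²`, which turns the L² bound into an L¹ bound.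
  set R : ℝ := 1 + ∑' k : ℕ, C ^ 2 * (1 / ((k : ℝ) + 1) ^ 2)
  have hL1 : ∀ n, eLpNorm (M n) 1 μ ≤ (R.toNNReal : ℝ≥0∞) := by
    intro n
    rw [eLpNorm_one_eq_lintegral_enorm, ← ofReal_integral_norm_eq_lintegral_enorm (hint n)]
    refine ENNReal.ofReal_le_ofReal ?_
    calc ∫ ω, ‖M n ω‖ ∂μ ≤ ∫ ω, (1 + M n ω ^ 2) ∂μ := by
          refine integral_mono (hint n).norm ((integrable_const _).add (hsq n)) fun ω => ?_
          rw [Real.norm_eq_abs, ← sq_abs]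
          nlinarith [sq_nonneg (|M n ω| - 1), abs_nonneg (M n ω)]
      _ = 1 + ∫ ω, M n ω ^ 2 ∂μ := by
          rw [integral_add (integrable_const _) (hsq n)]; simp
      _ ≤ R := by
          have := hsummable.sum_le_tsum (Finset.range n) (fun k _ => by positivity)
          have := hsecond n
          simp only [R]; linarith
  filter_upwards [hmart.submartingale.ae_tendsto_limitProcess hL1] with ω hω
  exact tendsto_average_of_tendsto_weighted_sum hω

instance {E : Type*} [MeasurableSpace E] (P : Kernel E E) [IsMarkovKernel P] (x : E) :
    IsProbabilityMeasure (pathLaw P x) := by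
  unfold pathLaw; infer_instance

/-- Time averages of `g - P g` along the chain tend to zero almost surely. -/
lemma ae_tendsto_average_sub_kernel {E : Type*} [MeasurableSpace E] (P : Kernel E E)
    [IsMarkovKernel P] (x : E) {g : E → ℝ} (hg : Measurable g) {C : ℝ} (hC : ∀ y, |g y| ≤ C) :
    ∀ᵐ ω ∂(pathLaw P x), Tendsto (fun n : ℕ => (n : ℝ)⁻¹ *
      ∑ k ∈ Finset.range n, (g (ω k) - ∫ y, g y ∂(P (ω k)))) atTop (𝓝 0) := by
  have hPg : Measurable fun y => ∫ z, g z ∂(P y) :=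
    (StronglyMeasurable.integral_kernel (κ := P) hg.stronglyMeasurable).measurable
  have hPgC : ∀ y, |∫ z, g z ∂(P y)| ≤ C := by
    intro y
    have := norm_integral_le_of_norm_le_const (μ := P y) (f := g) (ae_of_all _ hC)
    simpa using this
  have hcoord : ∀ k, Measurable[Filtration.piLE (X := fun _ : ℕ => E) k] fun ω : ℕ → E => ω k := by
    intro k
    rw [Filtration.piLE_eq_comap_frestrictLe]
    exact (measurable_pi_apply (⟨k, Finset.mem_Iic.2 le_rfl⟩ : Finset.Iic k)).comp
      (comap_measurable (Preorder.frestrictLe (π := fun _ : ℕ => E) k))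
  have key := ae_tendsto_average_of_condExp_eq_zero (μ := pathLaw P x)
    (Filtration.piLE (X := fun _ : ℕ => E))
    (d := fun k ω => g (ω (k + 1)) - ∫ y, g y ∂(P (ω k))) (C := C + C) ?_ ?_ ?_
  · filter_upwards [key] with ω hω
    -- Replacing `g (ω (k + 1))` by `g (ω k)` costs only a bounded telescoping sum.
    have htel : Tendsto (fun n : ℕ => (n : ℝ)⁻¹ * (g (ω 0) - g (ω n))) atTop (𝓝 0) := by
      refine squeeze_zero_norm (a := fun n : ℕ => (n : ℝ)⁻¹ * (C + C)) (fun n => ?_) ?_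
      · rw [norm_mul, Real.norm_of_nonneg (by positivity : (0 : ℝ) ≤ (n : ℝ)⁻¹)]
        gcongr
        exact (norm_sub_le _ _).trans (add_le_add (hC _) (hC _))
      · simpa using tendsto_inv_atTop_nhds_zero_nat.mul_const (C + C)
    have := hω.add htel
    rw [add_zero] at this
    refine this.congr fun n => ?_
    rw [← mul_add, ← Finset.sum_range_sub' (fun k => g (ω k)) n, ← Finset.sum_add_distrib]
    congr 1
    refine Finset.sum_congr rfl fun k _ => ?_
    ring
  · intro k
    refine Measurable.stronglyMeasurable ?_
    exact (hg.comp (hcoord (k + 1))).sub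
      (hPg.comp ((hcoord k).mono ((Filtration.piLE (X := fun _ : ℕ => E)).mono k.le_succ) le_rfl))
  · intro k ω
    exact (abs_sub _ _).trans (add_le_add (hC _) (hPgC _))
  · intro k
    have hi1 : Integrable (fun ω : ℕ → E => g (ω (k + 1))) (pathLaw P x) :=
      Integrable.of_bound (hg.comp (measurable_pi_apply (k + 1))).aestronglyMeasurable C
        (ae_of_all _ fun ω => hC _)
    have hi2 : Integrable (fun ω : ℕ → E => ∫ y, g y ∂(P (ω k))) (pathLaw P x) :=
      Integrable.of_bound (hPg.comp (measurable_pi_apply k)).aestronglyMeasurable C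
        (ae_of_all _ fun ω => hPgC _)
    have h1 := condExp_sub hi1 hi2 (Filtration.piLE (X := fun _ : ℕ => E) k)
    have h2 := condExp_of_stronglyMeasurable ((Filtration.piLE (X := fun _ : ℕ => E)).le k)
      (hPg.comp (hcoord k)).stronglyMeasurable hi2
    have h3 := Kernel.condExp_traj (X := fun _ : ℕ => E)
      (κ := fun n => P.comap (fun h : (i : Finset.Iic n) → E => h ⟨n, Finset.mem_Iic.2 le_rfl⟩)
      (measurable_pi_apply _)) (Nat.zero_le k) hi1
    filter_upwards [h1, h3] with ω h1 h3
    have h4 : ((pathLaw P x)[fun ω : ℕ → E => g (ω (k + 1)) |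
        Filtration.piLE (X := fun _ : ℕ => E) k])
        ω = ∫ y, g y ∂(P (ω k)) := by
      refine h3.trans ?_
      rw [← integral_map (φ := fun ω : ℕ → E => ω (k + 1))
        (measurable_pi_apply (k + 1)).aemeasurable
        hg.aestronglyMeasurable, ← Kernel.map_apply _ (measurable_pi_apply (k + 1)),
        Kernel.map_traj_succ_self]
      rfl
    have h5 : ((pathLaw P x)[fun ω : ℕ → E => ∫ y, g y ∂(P (ω k)) |
        Filtration.piLE (X := fun _ : ℕ => E) k]) ω = ∫ y, g y ∂(P (ω k)) := congrFun h2 ω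
    refine h1.trans ?_
    rw [Pi.sub_apply, h4, h5, sub_self, Pi.zero_apply]

/-! ### Consequence of compact images; occupation measures -/

/-- If `H` maps compact sets to compact sets, then a cluster value `w ≠ H x` of `H` at `x` is
isolated among the values of `H` near `x`. -/
lemma eventually_eq_of_image_isCompact {E W : Type*} [TopologicalSpace E]
    [FirstCountableTopology E] [TopologicalSpace W] [FirstCountableTopology W] [T2Space W]
    {H : E → W} (hH : ∀ K : Set E, IsCompact K → IsCompact (H '' K)) {x : E} {w : W}
    (hw : w ≠ H x) : ∀ᶠ p in 𝓝 w ×ˢ 𝓝 x, H p.2 = p.1 → p.1 = w := by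
  by_contra hcon
  rw [not_eventually] at hcon
  obtain ⟨p, hp, hpn⟩ := exists_seq_forall_of_frequently hcon
  simp only [Classical.not_imp] at hpn
  have hx : Tendsto (fun n => (p n).2) atTop (𝓝 x) := tendsto_snd.comp hp
  have hw' : Tendsto (fun n => (p n).1) atTop (𝓝 w) := tendsto_fst.comp hp
  -- A convergent sequence together with its limit is compact, so its image is closed and must
  -- contain the limit `w` of the values.
  have hcl := (hH _ hx.isCompact_insert_range).isClosed
  have hmem : w ∈ H '' insert x (Set.range fun n => (p n).2) := by
    refine hcl.mem_of_tendsto hw' (Eventually.of_forall fun n => ?_)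
    exact ⟨(p n).2, Set.mem_insert_of_mem _ ⟨n, rfl⟩, (hpn n).1⟩
  obtain ⟨y, rfl | ⟨n, rfl⟩, hy⟩ := hmem
  · exact hw hy.symm
  · exact (hpn n).2 ((hpn n).1.symm.trans hy)

lemma integral_occupationMeasure {E : Type*} [MeasurableSpace E] {f : E → ℝ} (hf : Measurable f)
    (ω : ℕ → E) (n : ℕ) :
    ∫ y, f y ∂(occupationMeasure ω n) = (n : ℝ)⁻¹ * ∑ k ∈ Finset.range n, f (ω k) := by
  have hi : ∀ k, Integrable f (Measure.dirac (ω k)) := fun k =>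
    integrable_dirac' hf.stronglyMeasurable (by simp)
  rw [occupationMeasure, integral_smul_measure, integral_finsetSum_measure fun k _ => hi k]
  simp [integral_dirac' f _ hf.stronglyMeasurable]

/-- The index is shifted because at index 0 the definition gives `∞ • 0 = 0`. -/
instance {E : Type*} [MeasurableSpace E] (ω : ℕ → E) (n : ℕ) :
    IsProbabilityMeasure (occupationMeasure ω (n + 1)) := by
  constructor
  simp only [occupationMeasure, Measure.smul_apply, Measure.coe_finsetSum, Finset.sum_apply,
    measure_univ, Finset.sum_const, Finset.card_range, smul_eq_mul, nsmul_eq_mul, mul_one]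
  exact ENNReal.inv_mul_cancel (by simp) (ENNReal.natCast_ne_top _)

/-! ### Regeneration at an atom -/

section Excursion

variable {E : Type*} [MeasurableSpace E]

/-- The law after one step of the chain killed on `A`, started from `ν`. -/
noncomputable def killedStep (P : Kernel E E) (A : Set E) (ν : Measure E) : Measure E :=
  (ν.restrict Aᶜ).bind P

/-- The expected occupation measure of the chain started from `ν` up to its first visit to `A`. -/
noncomputable def excursionMeasure (P : Kernel E E) (A : Set E) (ν : Measure E) : Measure E :=
  Measure.sum fun k => (killedStep P A)^[k] ν

/-- The expected sum of `g` over the first `M` steps of the chain, up to its first visit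
to `A`. -/
noncomputable def excursionPotential (P : Kernel E E) (A : Set E) (g : E → ℝ≥0∞) :
    ℕ → E → ℝ≥0∞
  | 0 => 0
  | M + 1 => fun x => g x + Aᶜ.indicator (fun x => ∫⁻ y, excursionPotential P A g M y ∂(P x)) x

variable {P : Kernel E E} {A : Set E} {g : E → ℝ≥0∞}

lemma measurable_excursionPotential (hA : MeasurableSet A) (hg : Measurable g) (M : ℕ) :
    Measurable (excursionPotential P A g M) := by
  induction M with
  | zero => exact measurable_const
  | succ M ih => exact hg.add (ih.lintegral_kernel.indicator hA.compl)

lemma excursionPotential_le [IsMarkovKernel P] (hg : ∀ x, g x ≤ 1) (M : ℕ) (x : E) :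
    excursionPotential P A g M x ≤ M := by
  induction M generalizing x with
  | zero => simp [excursionPotential]
  | succ M ih =>
    have h1 : ∫⁻ y, excursionPotential P A g M y ∂(P x) ≤ M := by
      calc _ ≤ ∫⁻ _, (M : ℝ≥0∞) ∂(P x) := lintegral_mono ih
        _ = M := by simp
    have h2 := Set.indicator_le_self' (s := Aᶜ)
      (f := fun x => ∫⁻ y, excursionPotential P A g M y ∂(P x)) (fun _ _ => zero_le) x
    rw [Nat.cast_succ, add_comm (M : ℝ≥0∞)]
    exact add_le_add (hg x) (h2.trans h1)

lemma excursionPotential_le_succ (M : ℕ) (x : E) :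
    excursionPotential P A g M x ≤ excursionPotential P A g (M + 1) x := by
  induction M generalizing x with
  | zero => simp [excursionPotential]
  | succ M ih =>
    exact add_le_add le_rfl (Set.indicator_le_indicator (lintegral_mono ih))

/-- Duality between moving `ν` forward by the killed kernel and pulling `g` back. The induction
varies `ν`, since one killed step changes it. -/
lemma lintegral_excursionPotential (hA : MeasurableSet A) (hg : Measurable g) (M : ℕ)
    (ν : Measure E) : ∫⁻ x, excursionPotential P A g M x ∂ν
      = ∑ k ∈ Finset.range M, ∫⁻ x, g x ∂((killedStep P A)^[k] ν) := by
  induction M generalizing ν with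
  | zero => simp [excursionPotential]
  | succ M ih =>
    have hm := measurable_excursionPotential (P := P) hA hg M
    rw [Finset.sum_range_succ', add_comm (Finset.sum _ _)]
    simp only [Function.iterate_succ_apply, Function.iterate_zero, id_eq]
    rw [← ih, killedStep, Measure.lintegral_bind P.aemeasurable hm.aemeasurable,
      ← lintegral_indicator hA.compl, ← lintegral_add_left hg]
    rfl

/-- Off `A` this is the recursion plus monotonicity in `M`. On `A` the recursion stops at `g`, and
the extra term on the left is exactly `P` of the potential, because `P x = q`. Averaged along the
chain, it compares visits to `A` with the averages of `g`. -/
lemma excursionPotential_drift {q : Measure E}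
    (hq : ∀ x ∈ A, P x = q) (M : ℕ) (x : E) :
    excursionPotential P A g M x
        + A.indicator (fun _ => ∫⁻ y, excursionPotential P A g M y ∂q) x
      ≤ g x + ∫⁻ y, excursionPotential P A g M y ∂(P x) := by
  by_cases hx : x ∈ A
  · rw [Set.indicator_of_mem hx, hq x hx]
    gcongr
    refine (excursionPotential_le_succ M x).trans ?_
    simp [excursionPotential, hx]
  · rw [Set.indicator_of_notMem hx, add_zero]
    refine (excursionPotential_le_succ M x).trans ?_
    simp [excursionPotential, hx]

/-- Gives finiteness of the truncated sums, so that `toReal` loses nothing. -/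
lemma sum_iterate_killedStep_le [IsMarkovKernel P] (hA : MeasurableSet A) {q : Measure E}
    [IsProbabilityMeasure q] {B : Set E} (hB : MeasurableSet B) (M : ℕ) :
    ∑ k ∈ Finset.range M, (killedStep P A)^[k] q B ≤ M := by
  have h1 := lintegral_excursionPotential (P := P) hA (measurable_one.indicator hB) M q
  simp only [lintegral_indicator_one hB] at h1
  rw [← h1]
  exact (lintegral_mono (excursionPotential_le
    (fun y => Set.indicator_le_self' (fun _ _ => zero_le) y) M)).trans (by simp)

lemma killedStep_apply (ν : Measure E) {s : Set E} (hs : MeasurableSet s) :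
    killedStep P A ν s = ∫⁻ x in Aᶜ, P x s ∂ν := by
  rw [killedStep, Measure.bind_apply hs P.aemeasurable]

lemma excursionMeasure_apply (ν : Measure E) {s : Set E} (hs : MeasurableSet s) :
    excursionMeasure P A ν s = ∑' k, (killedStep P A)^[k] ν s :=
  Measure.sum_apply _ hs

lemma le_excursionMeasure (ν : Measure E) : ν ≤ excursionMeasure P A ν :=
  Measure.le_sum (fun k => (killedStep P A)^[k] ν) 0

/-- Each killed step carries over precisely the mass lying off `A`, so the total mass is `1 + π Aᶜ`;
finiteness allows cancelling `π Aᶜ`. -/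
lemma excursionMeasure_eq_one [IsMarkovKernel P] (hA : MeasurableSet A) {q : Measure E}
    [IsProbabilityMeasure q] (hfin : excursionMeasure P A q Set.univ ≠ ∞) :
    excursionMeasure P A q A = 1 := by
  have h1 : excursionMeasure P A q Set.univ = 1 + excursionMeasure P A q Aᶜ := by
    rw [excursionMeasure_apply q .univ, excursionMeasure_apply q hA.compl,
      tsum_eq_zero_add' ENNReal.summable]
    simp only [Function.iterate_zero, id_eq, measure_univ, Function.iterate_succ_apply']
    congr 1
    refine tsum_congr fun k => ?_
    rw [killedStep_apply _ .univ]
    simp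
  rw [← measure_add_measure_compl hA] at h1 hfin
  exact (ENNReal.add_left_inj fun h => hfin (by rw [h, add_top])).1 h1

/-- Cycle formula: the unit mass on `A` is sent to `q`, the term `k = 0`, while the part of term `k`
off `A` is sent to term `k + 1`. -/
lemma invariant_excursionMeasure [IsMarkovKernel P] (hA : MeasurableSet A) {q : Measure E}
    [IsProbabilityMeasure q] (hq : ∀ x ∈ A, P x = q)
    (hfin : excursionMeasure P A q Set.univ ≠ ∞) :
    Kernel.Invariant P (excursionMeasure P A q) := by
  ext s hs
  rw [Measure.bind_apply hs P.aemeasurable, ← lintegral_add_compl _ hA,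
    setLIntegral_congr_fun hA (fun x hx => by rw [hq x hx] : Set.EqOn _ (fun _ => q s) A),
    setLIntegral_const, excursionMeasure_eq_one hA hfin, mul_one,
    excursionMeasure_apply q hs, tsum_eq_zero_add' ENNReal.summable]
  congr 1
  rw [excursionMeasure, Measure.restrict_sum _ hA.compl, lintegral_sum_measure]
  refine tsum_congr fun k => ?_
  rw [Function.iterate_succ_apply', killedStep_apply _ hs]

lemma excursionMeasure_null_of_forall_invariant [IsMarkovKernel P] (hA : MeasurableSet A)
    {q : Measure E} [IsProbabilityMeasure q] (hq : ∀ x ∈ A, P x = q)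
    (hfin : excursionMeasure P A q Set.univ ≠ ∞) {D : Set E}
    (hD : ∀ μ : Measure E, IsProbabilityMeasure μ → Kernel.Invariant P μ → μ D = 0) :
    excursionMeasure P A q D = 0 := by
  set π := excursionMeasure P A q with hπ
  have h0 : π Set.univ ≠ 0 := by
    have := le_excursionMeasure (P := P) (A := A) q Set.univ
    rw [measure_univ] at this
    exact (zero_lt_one.trans_le this).ne'
  have h1 := hD ((π Set.univ)⁻¹ • π) ⟨by
    rw [Measure.smul_apply, smul_eq_mul, ENNReal.inv_mul_cancel h0 hfin]⟩ (by
    ext s hs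
    rw [Measure.bind_apply hs P.aemeasurable, lintegral_smul_measure, Measure.smul_apply,
      ← Measure.bind_apply hs P.aemeasurable,
      (invariant_excursionMeasure hA hq hfin).def])
  simpa [hfin] using h1

/-- Along almost every trajectory, the frequency of visits to a set `B` is asymptotically at least
the frequency of visits to the atom `A` times the truncated excursion measure of `B`. -/
lemma ae_eventually_frequency_atom_mul_le [IsMarkovKernel P] (x : E) (hA : MeasurableSet A)
    {q : Measure E} [IsProbabilityMeasure q] (hq : ∀ x ∈ A, P x = q) {B : Set E}
    (hB : MeasurableSet B) (M : ℕ) :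
    ∀ᵐ ω ∂(pathLaw P x), ∀ ε > 0, ∀ᶠ n in atTop,
      (occupationMeasure ω n).real A * (∑ k ∈ Finset.range M, (killedStep P A)^[k] q B).toReal
        ≤ (occupationMeasure ω n).real B + ε := by
  set g : E → ℝ≥0∞ := B.indicator 1 with hgdef
  have hg : Measurable g := measurable_one.indicator hB
  have hg1 : ∀ y, g y ≤ 1 := fun y => Set.indicator_le_self' (fun _ _ => zero_le) y
  set v := excursionPotential P A g M with hv
  have hvm : Measurable v := measurable_excursionPotential hA hg M
  have hvle : ∀ y, v y ≤ M := excursionPotential_le hg1 M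
  have hvtop : ∀ y, v y ≠ ∞ := fun y => ne_top_of_le_ne_top (ENNReal.natCast_ne_top M) (hvle y)
  have hqv : ∫⁻ y, v y ∂q = ∑ k ∈ Finset.range M, (killedStep P A)^[k] q B := by
    rw [hv, lintegral_excursionPotential hA hg]
    simp [hgdef, lintegral_indicator_one hB]
  have hlint : ∀ (ν : Measure E) [IsProbabilityMeasure ν], ∫⁻ y, v y ∂ν ≠ ∞ := fun ν _ =>
    ne_top_of_le_ne_top (ENNReal.natCast_ne_top M)
      ((lintegral_mono hvle).trans (by simp))
  set c := (∑ k ∈ Finset.range M, (killedStep P A)^[k] q B).toReal with hc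
  have hdrift : ∀ y, (v y).toReal + A.indicator (fun _ => c) y
      ≤ B.indicator (fun _ => 1) y + ∫ z, (v z).toReal ∂(P y) := by
    intro y
    have h1 := excursionPotential_drift (g := g) hq M y
    rw [← hv, hqv] at h1
    have h2 : g y + ∫⁻ z, v z ∂(P y) ≠ ∞ :=
      ENNReal.add_ne_top.2 ⟨ne_top_of_le_ne_top ENNReal.one_ne_top (hg1 y), hlint _⟩
    have h3 := ENNReal.toReal_mono h2 h1
    have h4 : A.indicator (fun _ => ∑ k ∈ Finset.range M, (killedStep P A)^[k] q B) y ≠ ∞ :=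
      fun h => ne_top_of_le_ne_top h2 h1 (by rw [h, add_top])
    rw [ENNReal.toReal_add (hvtop y) h4,
      ENNReal.toReal_add (ne_top_of_le_ne_top ENNReal.one_ne_top (hg1 y)) (hlint _)] at h3
    rw [integral_toReal hvm.aemeasurable (ae_of_all _ fun z => (hvtop z).lt_top)]
    convert! h3 using 2
    · by_cases hy : y ∈ A <;> simp [hy, hc]
    · by_cases hy : y ∈ B <;> simp [hy, hgdef]
  filter_upwards [ae_tendsto_average_sub_kernel P x hvm.ennreal_toReal (C := M) fun y => by
    rw [abs_of_nonneg ENNReal.toReal_nonneg]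
    exact ENNReal.toReal_le_of_le_ofReal (by positivity) (by simpa using hvle y)] with ω hω ε hε
  filter_upwards [hω.eventually (lt_mem_nhds (neg_lt_zero.2 hε))] with n hn
  have hfreq : ∀ {s : Set E}, MeasurableSet s → (occupationMeasure ω n).real s
      = (n : ℝ)⁻¹ * ∑ k ∈ Finset.range n, s.indicator (fun _ => 1) (ω k) := fun hs => by
    rw [← integral_occupationMeasure (measurable_const.indicator hs), integral_indicator hs]
    simp
  have hsum : (n : ℝ)⁻¹ * ∑ k ∈ Finset.range n,
        ((v (ω k)).toReal - ∫ z, (v z).toReal ∂(P (ω k)))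
      ≤ (n : ℝ)⁻¹ * ∑ k ∈ Finset.range n,
        (B.indicator (fun _ => (1 : ℝ)) (ω k) - A.indicator (fun _ => (1 : ℝ)) (ω k) * c) := by
    refine mul_le_mul_of_nonneg_left (Finset.sum_le_sum fun k _ => ?_) (by positivity)
    have h1 := hdrift (ω k)
    have h2 : A.indicator (fun _ => (1 : ℝ)) (ω k) * c = A.indicator (fun _ => c) (ω k) := by
      by_cases hy : ω k ∈ A <;> simp [hy]
    linarith
  rw [hfreq hA, hfreq hB]
  rw [Finset.sum_sub_distrib (fun k => B.indicator (fun _ => (1 : ℝ)) (ω k)), mul_sub,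
    ← Finset.sum_mul, ← mul_assoc] at hsum
  linarith

/-- If all invariant probability measures vanish on `D`, then along almost every trajectory, the
chain spends little time in the part of the atom `A` close to `D`. -/
lemma ae_exists_isOpen_frequency_atom_le [TopologicalSpace E] [PolishSpace E] [BorelSpace E]
    [IsMarkovKernel P] (x : E) (hA : MeasurableSet A)
    {q : Measure E} [IsProbabilityMeasure q] (hq : ∀ x ∈ A, P x = q) {D : Set E}
    (hD : ∀ μ : Measure E, IsProbabilityMeasure μ → Kernel.Invariant P μ → μ D = 0) :
    ∀ᵐ ω ∂(pathLaw P x), ∀ ε > 0, ∃ U, IsOpen U ∧ D ⊆ U ∧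
      ∀ᶠ n in atTop, (occupationMeasure ω (n + 1)).real (A ∩ U) ≤ ε := by
  set π := excursionMeasure P A q with hπ
  have hlim : ∀ {s : Set E}, MeasurableSet s → Tendsto
      (fun M => ∑ k ∈ Finset.range M, (killedStep P A)^[k] q s) atTop (𝓝 (π s)) := fun hs => by
    rw [hπ, excursionMeasure_apply q hs]
    exact ENNReal.tendsto_nat_tsum _
  by_cases hfin : π Set.univ = ∞
  · filter_upwards [ae_all_iff.2 fun M =>
      ae_eventually_frequency_atom_mul_le x hA hq MeasurableSet.univ M] with ω hω ε hε
    refine ⟨Set.univ, isOpen_univ, Set.subset_univ _, ?_⟩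
    have h1 := hlim MeasurableSet.univ
    rw [hfin] at h1
    -- With `B = univ` and error 1, the frequency of `A` times `2 / ε` is at most `1 + 1`.
    obtain ⟨M, hM⟩ := (h1.eventually (lt_mem_nhds (ENNReal.ofReal_lt_top (r := 2 / ε)))).exists
    have hM' := (ENNReal.ofReal_lt_iff_lt_toReal (by positivity) (ne_top_of_le_ne_top
      (ENNReal.natCast_ne_top M) (sum_iterate_killedStep_le hA .univ M))).1 hM
    filter_upwards [(tendsto_add_atTop_nat 1).eventually (hω M 1 one_pos)] with n hn
    rw [Set.inter_univ]
    have h2 : (occupationMeasure ω (n + 1)).real A * (2 / ε) ≤ 2 := by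
      refine (mul_le_mul_of_nonneg_left hM'.le measureReal_nonneg).trans (hn.trans ?_)
      simp
      norm_num
    rw [mul_div_assoc', div_le_iff₀ hε] at h2
    linarith
  · have : IsFiniteMeasure π := ⟨lt_top_iff_ne_top.2 hfin⟩
    have hπD : π D = 0 := excursionMeasure_null_of_forall_invariant hA hq hfin hD
    have hπA : π A = 1 := excursionMeasure_eq_one hA hfin
    have hU : ∀ m : ℕ, ∃ U, D ⊆ U ∧ IsOpen U ∧ π U < ((m : ℝ≥0∞) + 1)⁻¹ := fun m =>
      D.exists_isOpen_lt_of_lt _ (by simp [hπD])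
    choose U hDU hUo hUlt using hU
    filter_upwards [ae_all_iff.2 fun m => ae_all_iff.2 fun M =>
      ae_eventually_frequency_atom_mul_le x hA hq (hA.diff (hUo m).measurableSet) M]
      with ω hω ε hε
    obtain ⟨m, hm⟩ := exists_nat_one_div_lt (by positivity : 0 < ε / 3)
    refine ⟨U m, hUo m, hDU m, ?_⟩
    have hUm : π.real (U m) < ε / 3 := by
      refine lt_trans ?_ hm
      rw [measureReal_def, ← ENNReal.lt_ofReal_iff_toReal_lt (measure_ne_top _ _)]
      convert! hUlt m using 1
      rw [one_div, ENNReal.ofReal_inv_of_pos (by positivity),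
        ENNReal.ofReal_add (by positivity) zero_le_one]
      simp
    have hAU : 1 ≤ π.real (A \ U m) + π.real (U m) := by
      have h1 := measureReal_union_le (μ := π) (A \ U m) (U m)
      have h2 := measureReal_mono (μ := π) (s₁ := A) (s₂ := A \ U m ∪ U m) (by simp)
      have h3 : π.real A = 1 := by simp [measureReal_def, hπA]
      linarith
    have hlim' := (ENNReal.tendsto_toReal (measure_ne_top π (A \ U m))).comp
      (hlim (hA.diff (hUo m).measurableSet))
    -- Since `π (A \ U m) > 1 - ε/3`, truncation can keep more than `1 - 2ε/3`. The frequency of `A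
    -- \ U m` is then at least that of `A` times `1 - 2ε/3`, minus `ε/3`, leaving at most `ε` for `A
    -- ∩ U m`.
    obtain ⟨M, hM⟩ := (hlim'.eventually (lt_mem_nhds
      (by rw [measureReal_def π (A \ U m)] at hAU; linarith :
        1 - 2 * (ε / 3) < (π (A \ U m)).toReal))).exists
    filter_upwards [(tendsto_add_atTop_nat 1).eventually (hω m M (ε / 3) (by positivity))]
      with n hn
    have h1 := (mul_le_mul_of_nonneg_left hM.le measureReal_nonneg).trans hn
    have h2 := measureReal_inter_add_sdiff (μ := occupationMeasure ω (n + 1)) (s := A)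
      (hUo m).measurableSet
    have h3 : (occupationMeasure ω (n + 1)).real A ≤ 1 := measureReal_le_one
    nlinarith

end Excursion
-- Countable families of test functions
/-- On a second countable metrizable space, countably many bounded continuous functions determine
probability measures. -/
lemma exists_countable_measure_determining (E : Type*) [TopologicalSpace E] [PolishSpace E]
    [MeasurableSpace E] [BorelSpace E] : ∃ F : Set (E →ᵇ ℝ), F.Countable ∧
      ∀ (μ ν : Measure E) [IsProbabilityMeasure μ] [IsProbabilityMeasure ν],
        (∀ f ∈ F, ∫ y, f y ∂μ = ∫ y, f y ∂ν) → μ = ν := by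
  let B := TopologicalSpace.countableBasis E
  have : Countable B := (TopologicalSpace.countable_countableBasis E).to_subtype
  -- Finite intersections of basic open sets form a countable generating π-system.
  let O : Finset B → Set E := fun s => ⋂ b ∈ s, (b : Set E)
  have hO : ∀ s, IsOpen (O s) := fun s =>
    isOpen_biInter_finset fun b _ => TopologicalSpace.isOpen_of_mem_countableBasis b.2
  let φ : Finset B × ℕ → (E →ᵇ ℝ) := fun p =>
    ⟨⟨fun x => ((hO p.1).isClosed_compl.apprSeq p.2 x : ℝ), by fun_prop⟩,
      ((hO p.1).isClosed_compl.apprSeq p.2).map_bounded'⟩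
  refine ⟨Set.range φ, Set.countable_range φ, fun μ ν _ _ h => ?_⟩
  have hc : ∀ s, μ (O s) = ν (O s) := by
    intro s
    have h1 := HasOuterApproxClosed.tendsto_lintegral_apprSeq (hO s).isClosed_compl μ
    have h2 := HasOuterApproxClosed.tendsto_lintegral_apprSeq (hO s).isClosed_compl ν
    have h3 : ∀ n, ∫⁻ x, (hO s).isClosed_compl.apprSeq n x ∂μ
        = ∫⁻ x, (hO s).isClosed_compl.apprSeq n x ∂ν := by
      intro n
      apply (ENNReal.toReal_eq_toReal_iff' (BoundedContinuousFunction.lintegral_lt_top_of_nnreal μ _).ne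
        (BoundedContinuousFunction.lintegral_lt_top_of_nnreal ν _).ne).mp
      rw [BoundedContinuousFunction.toReal_lintegral_coe_eq_integral,
        BoundedContinuousFunction.toReal_lintegral_coe_eq_integral]
      exact h (φ (s, n)) ⟨_, rfl⟩
    simp_rw [h3] at h1
    have h4 := tendsto_nhds_unique h1 h2
    rw [← compl_compl (O s), prob_compl_eq_one_sub (hO s).measurableSet.compl,
      prob_compl_eq_one_sub (hO s).measurableSet.compl, h4]
  refine ext_of_generate_finite (Set.range O) ?_ ?_ ?_ (by simp)
  · rw [BorelSpace.measurable_eq (α := E)]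
    refine le_antisymm ?_ (MeasurableSpace.generateFrom_le ?_)
    · rw [(TopologicalSpace.isBasis_countableBasis E).borel_eq_generateFrom]
      refine MeasurableSpace.generateFrom_mono fun b hb => ⟨{⟨b, hb⟩}, ?_⟩
      exact Finset.set_biInter_singleton (⟨b, hb⟩ : B) fun b => (b : Set E)
    · rintro _ ⟨s, rfl⟩
      exact MeasurableSpace.measurableSet_generateFrom (hO s)
  · classical
    rintro _ ⟨s, rfl⟩ _ ⟨t, rfl⟩ _
    exact ⟨s ∪ t, Finset.set_biInter_inter s t fun b => (b : Set E)⟩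
  · rintro _ ⟨s, rfl⟩
    exact hc s

/-! ### Limits of occupation measures on the graph of `H` -/

section Graph

variable {E : Type u} {W : Type v} [MeasurableSpace E] [MeasurableSpace W]

/-- The occupation measure of the pairs `(H (ω k), ω k)`, `k ≤ n`. -/
noncomputable def graphOccupation {H : E → W} (hH : Measurable H) (ω : ℕ → E) (n : ℕ) :
    ProbabilityMeasure (W × E) :=
  ⟨(occupationMeasure ω (n + 1)).map fun y => (H y, y),
    Measure.isProbabilityMeasure_map (hH.prodMk measurable_id).aemeasurable⟩

lemma coe_graphOccupation {H : E → W} (hH : Measurable H) (ω : ℕ → E) (n : ℕ) :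
    (graphOccupation hH ω n : Measure (W × E))
      = (occupationMeasure ω (n + 1)).map fun y => (H y, y) := rfl

variable [TopologicalSpace E] [PolishSpace E] [BorelSpace E]
  [TopologicalSpace W] [PolishSpace W] [BorelSpace W] {H : E → W}

lemma measure_le_of_tendsto_graphOccupation (hH : Measurable H) {ω : ℕ → E} {L : Filter ℕ}
    [L.NeBot] {Γ : ProbabilityMeasure (W × E)} (hΓ : Tendsto (graphOccupation hH ω) L (𝓝 Γ))
    {G : Set (W × E)} (hG : IsOpen G) {c : ℝ≥0∞}
    (hc : ∀ᶠ n in L, occupationMeasure ω (n + 1) {y | (H y, y) ∈ G} ≤ c) :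
    (Γ : Measure (W × E)) G ≤ c := by
  refine (ProbabilityMeasure.le_liminf_measure_open_of_tendsto hΓ hG).trans ?_
  refine liminf_le_of_frequently_le' (Eventually.frequently ?_)
  filter_upwards [hc] with n hn
  rw [coe_graphOccupation, Measure.map_apply (hH.prodMk measurable_id') hG.measurableSet]
  exact hn

/-- Tightness lifts from `E` to `W × E` because `H '' K ×ˢ K` is compact; Prokhorov's theorem then
gives the limit. -/
lemma exists_tendsto_graphOccupation (hH : Measurable H)
    (hK : ∀ K : Set E, IsCompact K → IsCompact (H '' K))
    {ω : ℕ → E} (hω : IsTightMeasureSet (occupationMeasure ω '' {n : ℕ | 1 ≤ n}))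
    (L : Ultrafilter ℕ) : ∃ Γ, Tendsto (graphOccupation hH ω) L (𝓝 Γ) := by
  have htight : IsTightMeasureSet {((μ : ProbabilityMeasure (W × E)) : Measure (W × E)) |
      μ ∈ Set.range (graphOccupation hH ω)} := by
    rw [isTightMeasureSet_iff_exists_isCompact_measure_compl_le] at hω ⊢
    intro ε hε
    obtain ⟨K, hKc, hKε⟩ := hω ε hε
    refine ⟨(H '' K) ×ˢ K, (hK K hKc).prod hKc, ?_⟩
    rintro _ ⟨_, ⟨n, rfl⟩, rfl⟩
    rw [coe_graphOccupation, Measure.map_apply (hH.prodMk measurable_id')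
      ((hK K hKc).prod hKc).measurableSet.compl]
    refine le_trans (measure_mono fun y hy => ?_) (hKε _ ⟨n + 1, Nat.le_add_left 1 n, rfl⟩)
    exact fun hyK => hy ⟨⟨y, hyK, rfl⟩, hyK⟩
  obtain ⟨Γ, -, hΓ⟩ := isCompact_iff_ultrafilter_le_nhds'.1
    (isCompact_closure_of_isTightMeasureSet htight) (L.map (graphOccupation hH ω))
    (mem_map.2 (Eventually.of_forall fun n => subset_closure ⟨n, rfl⟩))
  exact ⟨Γ, hΓ⟩

variable {P : Kernel E E} [IsMarkovKernel P] {Q : Kernel W E} [IsMarkovKernel Q]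

/-- Limit points of the occupation measures of the pairs `(H (ω k), ω k)` do not charge the
complement of the graph of `H`. -/
lemma ae_measure_compl_graph_eq_zero (hH : Measurable H)
    (hK : ∀ K : Set E, IsCompact K → IsCompact (H '' K))
    (hPQ : ∀ x, P x = Q (H x))
    (hD : ∀ μ : Measure E, IsProbabilityMeasure μ → Kernel.Invariant P μ →
      μ {x | ¬ ContinuousAt H x} = 0) (x : E) :
    ∀ᵐ ω ∂(pathLaw P x), ∀ (L : Filter ℕ) [L.NeBot], L ≤ atTop →
      ∀ Γ : ProbabilityMeasure (W × E), Tendsto (graphOccupation hH ω) L (𝓝 Γ) →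
        ∀ᵐ p ∂(Γ : Measure (W × E)), p.1 = H p.2 := by
  set D := {x | ¬ ContinuousAt H x} with hDdef
  let BE := TopologicalSpace.countableBasis E
  let BW := TopologicalSpace.countableBasis W
  have : Countable BE := (TopologicalSpace.countable_countableBasis E).to_subtype
  have : Countable BW := (TopologicalSpace.countable_countableBasis W).to_subtype
  -- Handling only countably many boxes gives one null set valid for all `L` and `Γ`, although there
  -- may be uncountably many atoms.
  have hatom : ∀ (V : BW) (U : BE), ∀ᵐ ω ∂(pathLaw P x),
      (∃ w, ∀ y ∈ (U : Set E), H y ∈ (V : Set W) → H y = w) → ∀ ε > 0, ∃ O, IsOpen O ∧ D ⊆ O ∧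
        ∀ᶠ n in atTop, (occupationMeasure ω (n + 1)).real
          ({y ∈ (U : Set E) | H y ∈ (V : Set W)} ∩ O) ≤ ε := by
    intro V U
    by_cases hw : ∃ w, ∀ y ∈ (U : Set E), H y ∈ (V : Set W) → H y = w
    · obtain ⟨w, hw⟩ := hw
      have hA : MeasurableSet (H ⁻¹' {w}) := hH (measurableSet_singleton w)
      filter_upwards [ae_exists_isOpen_frequency_atom_le x hA (q := Q w)
        (fun y hy => by rw [hPQ y, show H y = w from hy]) hD] with ω hω _ ε hε
      obtain ⟨O, hO, hDO, hn⟩ := hω ε hε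
      refine ⟨O, hO, hDO, hn.mono fun n hn => le_trans (measureReal_mono ?_) hn⟩
      exact Set.inter_subset_inter_left _ fun y hy => hw y hy.1 hy.2
    · exact ae_of_all _ fun ω h => absurd h hw
  filter_upwards [ae_all_iff.2 fun V => ae_all_iff.2 fun U => hatom V U] with ω hω L _ hL Γ hΓ
  have hnull1 : ∀ (V : BW) (U : BE), (∀ y ∈ (U : Set E), H y ∉ (V : Set W)) →
      (Γ : Measure (W × E)) ((V : Set W) ×ˢ (U : Set E)) = 0 := by
    intro V U hVU
    have hopen : IsOpen ((V : Set W) ×ˢ (U : Set E)) :=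
      (TopologicalSpace.isOpen_of_mem_countableBasis V.2).prod
        (TopologicalSpace.isOpen_of_mem_countableBasis U.2)
    refine le_antisymm (measure_le_of_tendsto_graphOccupation hH hΓ hopen
      (Eventually.of_forall fun n => ?_)) zero_le
    rw [show {y | (H y, y) ∈ (V : Set W) ×ˢ (U : Set E)} = ∅ from
      Set.eq_empty_of_forall_notMem fun y hy => hVU y hy.2 hy.1, measure_empty]
  have hnull2 : ∀ (V : BW) (U : BE), (∃ w, ∀ y ∈ (U : Set E), H y ∈ (V : Set W) → H y = w) →
      (Γ : Measure (W × E)) ((V : Set W) ×ˢ ((U : Set E) ∩ D)) = 0 := by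
    intro V U hVU
    refine le_antisymm (ENNReal.le_of_forall_pos_le_add fun ε hε _ => ?_) zero_le
    rw [zero_add]
    obtain ⟨O, hO, hDO, hn⟩ := hω V U hVU ε (by exact_mod_cast hε)
    have hopen : IsOpen ((V : Set W) ×ˢ ((U : Set E) ∩ O)) :=
      (TopologicalSpace.isOpen_of_mem_countableBasis V.2).prod
        ((TopologicalSpace.isOpen_of_mem_countableBasis U.2).inter hO)
    refine (measure_mono (Set.prod_mono_right (Set.inter_subset_inter_right _ hDO))).trans
      (measure_le_of_tendsto_graphOccupation hH hΓ hopen ((hn.filter_mono hL).mono fun n hn => ?_))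
    rw [measureReal_def] at hn
    rw [← ENNReal.ofReal_coe_nnreal, ← ENNReal.toReal_le_toReal (measure_ne_top _ _) (by simp),
      ENNReal.toReal_ofReal (by positivity)]
    refine le_trans (ENNReal.toReal_mono (measure_ne_top _ _) (measure_mono ?_)) hn
    exact fun y hy => ⟨⟨hy.2.1, hy.1⟩, hy.2.2⟩
  -- Boxes of the first kind surround off-graph points over continuity points of `H`; those of the
  -- second kind, over `D`, meet the graph only at height `w`.
  have hcover : {p : W × E | p.1 = H p.2}ᶜ ⊆
      (⋃ (V : BW) (U : BE) (_ : ∀ y ∈ (U : Set E), H y ∉ (V : Set W)),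
        (V : Set W) ×ˢ (U : Set E)) ∪
      ⋃ (V : BW) (U : BE) (_ : ∃ w, ∀ y ∈ (U : Set E), H y ∈ (V : Set W) → H y = w),
        (V : Set W) ×ˢ ((U : Set E) ∩ D) := by
    rintro ⟨w, y⟩ (hwy : w ≠ H y)
    have hbasis := (TopologicalSpace.isBasis_countableBasis W).nhds_hasBasis (a := w) |>.prod
      ((TopologicalSpace.isBasis_countableBasis E).nhds_hasBasis (a := y))
    have hev := eventually_eq_of_image_isCompact hK hwy
    by_cases hy : y ∈ D
    · right
      obtain ⟨⟨V, U⟩, ⟨⟨hV, hwV⟩, hU, hyU⟩, hVU⟩ := hbasis.eventually_iff.1 hev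
      simp only [Set.mem_iUnion]
      exact ⟨⟨V, hV⟩, ⟨U, hU⟩, ⟨w, fun z hz hzV => hVU (x := (H z, z)) ⟨hzV, hz⟩ rfl⟩, hwV, hyU, hy⟩
    · left
      have hcont : ContinuousAt H y := not_not.1 hy
      have hne : ∀ᶠ p in 𝓝 w ×ˢ 𝓝 y, p.1 ≠ H p.2 := by
        have h1 : Tendsto (fun p : W × E => (p.1, H p.2)) (𝓝 w ×ˢ 𝓝 y) (𝓝 (w, H y)) :=
          tendsto_fst.prodMk_nhds (hcont.tendsto.comp tendsto_snd)
        exact h1.eventually (isOpen_ne_fun continuous_fst continuous_snd |>.mem_nhds hwy)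
      obtain ⟨⟨V, U⟩, ⟨⟨hV, hwV⟩, hU, hyU⟩, hVU⟩ := hbasis.eventually_iff.1 hne
      simp only [Set.mem_iUnion]
      exact ⟨⟨V, hV⟩, ⟨U, hU⟩, fun z hz hzV => hVU (x := (H z, z)) ⟨hzV, hz⟩ rfl, hwV, hyU⟩
  refine measure_mono_null hcover (measure_union_null ?_ ?_) <;>
    refine measure_iUnion_null fun V => measure_iUnion_null fun U => measure_iUnion_null fun h => ?_
  · exact hnull1 V U h
  · exact hnull2 V U h

/-- Along almost every trajectory, the occupation measures converge weakly, along every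
ultrafilter, to an invariant probability measure. -/
lemma ae_forall_ultrafilter_exists_invariant (hH : Measurable H)
    (hK : ∀ K : Set E, IsCompact K → IsCompact (H '' K))
    (hQ : ∀ f : E →ᵇ ℝ, Continuous fun w => ∫ y, f y ∂(Q w))
    (hPQ : ∀ x, P x = Q (H x))
    (hD : ∀ μ : Measure E, IsProbabilityMeasure μ → Kernel.Invariant P μ →
      μ {x | ¬ ContinuousAt H x} = 0) (x : E) (htight : OccupationTightFrom P x) :
    ∀ᵐ ω ∂(pathLaw P x), ∀ L : Ultrafilter ℕ, (L : Filter ℕ) ≤ atTop →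
      ∃ μ : Measure E, IsProbabilityMeasure μ ∧ Kernel.Invariant P μ ∧ ∀ f : E →ᵇ ℝ,
        Tendsto (fun n => ∫ y, f y ∂(occupationMeasure ω (n + 1))) L (𝓝 (∫ y, f y ∂μ)) := by
  obtain ⟨F, hFc, hF⟩ := exists_countable_measure_determining E
  have hPm : ∀ f : E →ᵇ ℝ, Measurable fun y => ∫ z, f z ∂(P y) := fun f =>
    (StronglyMeasurable.integral_kernel (κ := P)
      f.continuous.measurable.stronglyMeasurable).measurable
  -- The exceptional null set depends on `f`, hence the countable family `F`.
  have hlln : ∀ᵐ ω ∂(pathLaw P x), ∀ f ∈ F, Tendsto (fun n : ℕ => (n : ℝ)⁻¹ *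
      ∑ k ∈ Finset.range n, (f (ω k) - ∫ y, f y ∂(P (ω k)))) atTop (𝓝 0) :=
    (ae_ball_iff hFc).2 fun f _ =>
      ae_tendsto_average_sub_kernel P x f.continuous.measurable (C := ‖f‖) f.norm_coe_le_norm
  filter_upwards [htight, hlln, ae_measure_compl_graph_eq_zero hH hK hPQ hD x]
    with ω hω hωF hgraph L hL
  obtain ⟨Γ, hΓ⟩ := exists_tendsto_graphOccupation hH hK hω L
  have hint := ProbabilityMeasure.tendsto_iff_forall_integral_tendsto.1 hΓ
  have hpair : Measurable fun y => (H y, y) := hH.prodMk measurable_id'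
  set μ := (Γ : Measure (W × E)).map Prod.snd with hμ
  have hμp : IsProbabilityMeasure μ := Measure.isProbabilityMeasure_map measurable_snd.aemeasurable
  have hconv : ∀ f : E →ᵇ ℝ,
      Tendsto (fun n => ∫ y, f y ∂(occupationMeasure ω (n + 1))) L (𝓝 (∫ y, f y ∂μ)) := by
    intro f
    have h1 := hint (f.compContinuous ⟨Prod.snd, continuous_snd⟩)
    rw [hμ, integral_map measurable_snd.aemeasurable
      f.continuous.measurable.aestronglyMeasurable]
    refine h1.congr fun n => ?_
    rw [coe_graphOccupation, integral_map hpair.aemeasurable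
      (BoundedContinuousFunction.continuous _).measurable.aestronglyMeasurable]
    rfl
  have hconvQ : ∀ f : E →ᵇ ℝ,
      Tendsto (fun n => ∫ y, (∫ z, f z ∂(P y)) ∂(occupationMeasure ω (n + 1))) L
        (𝓝 (∫ y, (∫ z, f z ∂(P y)) ∂μ)) := by
    intro f
    let Qf : W →ᵇ ℝ := BoundedContinuousFunction.ofNormedAddCommGroup
      (fun w => ∫ y, f y ∂(Q w)) (hQ f) ‖f‖ fun w => by
        simpa using norm_integral_le_of_norm_le_const (μ := Q w) (f := f)
          (ae_of_all _ f.norm_coe_le_norm)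
    have h1 := hint (Qf.compContinuous ⟨Prod.fst, continuous_fst⟩)
    have h2 : ∫ p, (Qf.compContinuous ⟨Prod.fst, continuous_fst⟩ : W × E →ᵇ ℝ) p ∂(Γ : Measure _)
        = ∫ y, (∫ z, f z ∂(P y)) ∂μ := by
      rw [hμ, integral_map measurable_snd.aemeasurable (hPm f).aestronglyMeasurable]
      -- Concentration on the graph is what replaces the continuous `Q f` by the possibly
      -- discontinuous `P f`.
      refine integral_congr_ae ?_
      filter_upwards [hgraph L hL Γ hΓ] with p hp
      change ∫ y, f y ∂(Q p.1) = ∫ y, f y ∂(P p.2)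
      rw [hp, hPQ]
    rw [h2] at h1
    refine h1.congr fun n => ?_
    rw [coe_graphOccupation, integral_map hpair.aemeasurable
      (BoundedContinuousFunction.continuous _).measurable.aestronglyMeasurable]
    simp_rw [hPQ]
    rfl
  refine ⟨μ, hμp, ?_, hconv⟩
  have : IsProbabilityMeasure (μ.bind P) := inferInstance
  refine (hF μ (μ.bind P) fun f hf => ?_).symm
  have h1 : ∫ y, f y ∂(μ.bind P) = ∫ y, (∫ z, f z ∂(P y)) ∂μ := by
    have h2 := Kernel.integral_comp (κ := Kernel.const Unit μ) (η := P) (a := ()) (f := f)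
      (f.integrable _)
    rwa [Kernel.comp_const, Kernel.const_apply, Kernel.const_apply] at h2
  rw [h1, ← sub_eq_zero]
  refine tendsto_nhds_unique ((hconv f).sub (hconvQ f))
    ((((hωF f hf).comp (tendsto_add_atTop_nat 1)).mono_left hL).congr fun n => ?_)
  rw [integral_occupationMeasure f.continuous.measurable, integral_occupationMeasure (hPm f),
    ← mul_sub, ← Finset.sum_sub_distrib]
  rfl

end Graph
end QuasiFellerChain

/-! ### Existence and stability -/

theorem mainTheorem7 {E : Type u} [TopologicalSpace E] [PolishSpace E] [Nonempty E]
    [MeasurableSpace E] [BorelSpace E] (P : Kernel E E) [IsMarkovKernel P]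
    (hP : QuasiFellerChain.IsQuasiFeller.{u, v} P)
    (htight : ∀ x : E, QuasiFellerChain.OccupationTightFrom P x) :
    (∃ μ : Measure E, IsProbabilityMeasure μ ∧ Kernel.Invariant P μ) ∧
    (∀ μ : Measure E, IsProbabilityMeasure μ → Kernel.Invariant P μ →
      (∀ ν : Measure E, IsProbabilityMeasure ν → Kernel.Invariant P ν → ν = μ) →
      QuasiFellerChain.IsDufloStableWithLimit P μ) := by
  obtain ⟨W, _, _, _, _, H, Q, _, hH, hK, hQ, hPQ, hD⟩ := hP
  have key := fun x =>
    QuasiFellerChain.ae_forall_ultrafilter_exists_invariant hH hK hQ hPQ hD x (htight x)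
  refine ⟨?_, fun μ hμ _ huniq => ⟨hμ, fun x f => ?_⟩⟩
  · obtain ⟨x⟩ := ‹Nonempty E›
    obtain ⟨ω, hω⟩ := (key x).exists
    obtain ⟨μ, hμ, hinv, -⟩ := hω (Ultrafilter.of atTop) (Ultrafilter.of_le _)
    exact ⟨μ, hμ, hinv⟩
  · filter_upwards [key x] with ω hω
    -- Convergence is tested along ultrafilters: each has an invariant limit, which uniqueness
    -- identifies with `μ`.
    rw [← tendsto_add_atTop_iff_nat 1, tendsto_iff_ultrafilter]
    intro L hL
    obtain ⟨ν, hν, hinv, hconv⟩ := hω L hL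
    rw [← huniq ν hν hinv]
    refine (hconv f).congr fun n => ?_
    rw [QuasiFellerChain.integral_occupationMeasure f.continuous.measurable]
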